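/- Let $A=(A^s)_{s=1}^{d}$ be complex $D\times D$ matrices. Assume that $A$ is in left-canonical form, i.e. $\sum_s (A^s)^\dagger A^s=\mathbb 1$ and there is a positive definite $\rho$ with $\sum_s A^s\rho (A^s)^\dagger=\rho$. Assume also that $A$ is injective: the transfer matrix $\mathbb E=\sum_s A^s\otimes (A^s)^*$ (with $^*$ the entrywise complex conjugate) has an eigenvalue whose eigenspace is one-dimensional and which is strictly larger in modulus than every other eigenvalue of $\mathbb E$. For $N\ge 1$ let $$|\psi_N\rangle=\sum_{s_1,\dots,s_N}\operatorname{Tr}(A^{s_1}\cdots A^{s_N})\,|s_1\cdots s_N\rangle\in(\mathbb C^d)^{\otimes N}$$ be the translation-invariant matrix product state on the periodic chain of $N$ sites generated by $A$. Let $L\ge 1$ and let $G$ be a set of labels (for example a symmetry group). For every $g\in G$ let $U_{g,1},\dots,U_{g,L}$ be unitary $d\times d$ matrices and $\mathcal U_g=\bigotimes_{j=1}^{L}U_{g,j}$. Assume that for every $g\in G$ and every integer $k\ge 1$ there is a real number $\theta_{g,k}$ such that $$\mathcal U_g^{\otimes k}\,|\psi_{kL}\rangle=e^{i\theta_{g,k}}\,|\psi_{kL}\rangle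 ,$$ that is, on the chain of $kL$ sites the state is an eigenstate of the $L$-periodic extension of the modulated symmetry. Then for every $g\in G$ there are unitary $D\times D$ matrices $v_0(g),v_1(g),\dots,v_L(g)$ and real numbers $\phi_1(g),\dots,\phi_L(g),\phi(g)$ such that $$\sum_{t=1}^{d}(U_{g,j})_{st}\,A^t=e^{i\phi_j(g)}\,v_{j-1}(g)^\dagger A^s\,v_j(g)\qquad\text{for all }1\le j\le L,\ 1\le s\le d,$$ and $$v_0(g)=e^{i\phi(g)}\,v_L(g).$$ In the shorthand $\doteq$ for equality up to a phase: $U_{g,j}\cdot A\doteq v_{j-1}(g)^\dagger A\,v_j(g)$ and $v_0(g)\doteq v_L(g)$. -/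

import Mathlib

open Matrix
open scoped Kronecker ComplexOrder

noncomputable section

namespace ModulatedMPS

/-- A site-independent MPS tensor with physical dimension `d` and bond dimension `D`:
a family of square matrices `A s` labelled by the physical index `s`. -/
abbrev Tensor (d D : ℕ) := Fin d → Matrix (Fin D) (Fin D) ℂ

/-- The coordinates, in the product basis, of a vector of the `N`-site space `(ℂ^d)^{⊗ N}`. -/
abbrev State (d N : ℕ) := (Fin N → Fin d) → ℂ

/-- Equality up to a phase: `x = e^{iθ} y` for some real `θ`. -/
def EqUpToPhase {M : Type*} [SMul ℂ M] (x y : M) : Prop :=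
  ∃ θ : ℝ, x = Complex.exp (θ * Complex.I) • y

/-- The translation-invariant periodic MPS on `N` sites, with amplitudes
`Tr (A^{s₁} ⋯ A^{s_N})`. -/
def periodicState {d D : ℕ} (A : Tensor d D) (N : ℕ) : State d N :=
  fun s => Matrix.trace (List.ofFn fun i => A (s i)).prod

/-- The transfer matrix `∑ₛ Aˢ ⊗ (Aˢ)^*`, where `^*` is the entrywise complex conjugate. -/
def transferMatrix {d D : ℕ} (A : Tensor d D) :
    Matrix (Fin D × Fin D) (Fin D × Fin D) ℂ :=
  ∑ s, A s ⊗ₖ (A s).map (starRingEnd ℂ)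

/-- Injectivity: the transfer matrix has a unique dominant eigenvalue (its eigenvector is unique
up to scaling), and every other eigenvalue is strictly smaller in modulus. -/
def IsInjective {d D : ℕ} (A : Tensor d D) : Prop :=
  ∃ μ : ℂ, Module.finrank ℂ (Module.End.eigenspace (Matrix.toLin' (transferMatrix A)) μ) = 1 ∧
    ∀ ν : ℂ, Module.End.HasEigenvalue (Matrix.toLin' (transferMatrix A)) ν → ν ≠ μ → ‖ν‖ < ‖μ‖

/-- Left-canonical form: the identity is the left fixed point of the transfer matrix, and there is
a positive definite (in particular full-rank) right fixed point `ρ`. -/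
structure IsLeftCanonical {d D : ℕ} (A : Tensor d D) : Prop where
  left_fixed : ∑ s, (A s)ᴴ * A s = 1
  right_fixed : ∃ ρ : Matrix (Fin D) (Fin D) ℂ, ρ.PosDef ∧ ∑ s, A s * ρ * (A s)ᴴ = ρ

/-- The matrix of `⨂ᵢ Uᵢ` in the product basis of the `N`-site space. -/
def onSiteOperator {d N : ℕ} (U : Fin N → Matrix.unitaryGroup (Fin d) ℂ) :
    Matrix (Fin N → Fin d) (Fin N → Fin d) ℂ :=
  Matrix.of fun s t => ∏ i, (U i : Matrix (Fin d) (Fin d) ℂ) (s i) (t i)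

/-- The `k`-fold periodic extension of on-site unitaries given on an `L`-site unit cell:
site `i` of the chain of `k * L` sites carries `U (i mod L)`. -/
def periodicExtension {d L : ℕ} (U : Fin L → Matrix.unitaryGroup (Fin d) ℂ) (k : ℕ) :
    Fin (k * L) → Matrix.unitaryGroup (Fin d) ℂ :=
  fun i => U i.modNat

/-- The action `U · A` of an on-site unitary on the physical leg:
`(U · A)^s = ∑ₜ U_{s t} A^t`. -/
def physicalAction {d D : ℕ} (U : Matrix.unitaryGroup (Fin d) ℂ) (A : Tensor d D) : Tensor d D :=
  fun s => ∑ t, (U : Matrix (Fin d) (Fin d) ℂ) s t • A t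

/-- The tensor `v† A w`, with matrices acting on the left and on the right bond. -/
def bondAction {d D : ℕ} (v w : Matrix.unitaryGroup (Fin D) ℂ) (A : Tensor d D) : Tensor d D :=
  fun s => (v : Matrix (Fin D) (Fin D) ℂ)ᴴ * A s * (w : Matrix (Fin D) (Fin D) ℂ)

end ModulatedMPS

end

noncomputable section

namespace ModulatedMPS

open Filter Topology

/-! ### Powers of matrices -/

/-! The overlap of the transformed state with the original on `k * L` sites is, up to conjugation,
the trace of the `k`-th power of one matrix, the product `M` of the mixed transfer matrices of a
unit cell. Symmetry gives it the modulus of `tr E^(kL)`, which tends to 1 because the powers of `Eᴴ`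
converge to a rank-one projection (`exists_tendsto_transferMatrix_pow`). So `Mᴴ` has an eigenvalue
`z` with `1 ≤ ‖z‖` (`exists_peripheral_eigenvector`).

Reshape its eigenvector into a matrix `X 0` and propagate it through the cell by the mixed channels,
ending at `X L = z • X 0`. Each channel contracts the norm `tr (X ρ Xᴴ)`, so that norm is constant
along the cell and `‖z‖ = 1`. Vanishing of the defect (`sum_trace_defect`) forces the intertwining
`X j * (U j · A)^s = A^s * X (j+1)`. Hence the Gram matrices `(X j)ᴴ * X j` follow the channel of
`A` and return to their start after one cell; by convergence of the powers they are one common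
scalar. Rescaled, the `X j` are the bond unitaries. -/

theorem tendsto_pow_zero_of_spectrum_lt_one {R : Type*} [NormedRing R] [NormedAlgebra ℂ R]
    [CompleteSpace R] [Nontrivial R] (a : R) (ha : ∀ z ∈ spectrum ℂ a, ‖z‖ < 1) :
    Tendsto (fun n : ℕ => a ^ n) atTop (𝓝 0) := by
  have h1 : spectralRadius ℂ a < (1 : NNReal) :=
    spectrum.spectralRadius_lt_of_forall_lt a fun z hz => by exact_mod_cast ha z hz
  -- Gelfand's formula: for `r` strictly between the spectral radius and 1, eventually `‖a ^ n‖ ≤ r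
  -- ^ n`.
  obtain ⟨r, hr0, hr1⟩ := ENNReal.lt_iff_exists_nnreal_btwn.mp h1
  have hr1' : r < 1 := by exact_mod_cast hr1
  have h2 := (spectrum.pow_nnnorm_pow_one_div_tendsto_nhds_spectralRadius a).eventually_lt_const hr0
  rw [tendsto_zero_iff_norm_tendsto_zero]
  refine squeeze_zero' (Eventually.of_forall fun n => norm_nonneg _) ?_
    (tendsto_pow_atTop_nhds_zero_of_lt_one r.2 (by exact_mod_cast hr1'))
  filter_upwards [h2, eventually_gt_atTop 0] with n hn hn0
  have h3 : ((‖a ^ n‖₊ : ENNReal) ^ (1 / n : ℝ)) ^ (n : ℝ) ≤ (r : ENNReal) ^ (n : ℝ) :=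
    ENNReal.rpow_le_rpow hn.le (by positivity)
  rw [← ENNReal.rpow_mul, one_div_mul_cancel (by positivity), ENNReal.rpow_one,
    ENNReal.rpow_natCast] at h3
  exact_mod_cast h3

section Powers

variable {n : Type*} [Fintype n] [DecidableEq n]

theorem exists_eigenvector_of_mem_spectrum {M : Matrix n n ℂ} {z : ℂ} (hz : z ∈ spectrum ℂ M) :
    ∃ x : n → ℂ, x ≠ 0 ∧ M *ᵥ x = z • x := by
  rw [← Matrix.spectrum_toLin'] at hz
  obtain ⟨x, hx⟩ := (Module.End.HasEigenvalue.of_mem_spectrum hz).exists_hasEigenvector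
  exact ⟨x, hx.2, by simpa using hx.apply_eq_smul⟩

theorem tendsto_matrix_pow_zero [Nonempty n] (M : Matrix n n ℂ)
    (hM : ∀ (z : ℂ) (x : n → ℂ), x ≠ 0 → M *ᵥ x = z • x → ‖z‖ < 1) :
    Tendsto (fun k : ℕ => M ^ k) atTop (𝓝 0) := by
  let _ := Matrix.linftyOpNormedRing (n := n) (α := ℂ)
  let _ := Matrix.linftyOpNormedAlgebra (R := ℂ) (n := n) (α := ℂ)
  have : CompleteSpace (Matrix n n ℂ) := FiniteDimensional.complete ℂ _
  refine tendsto_pow_zero_of_spectrum_lt_one M fun z hz => ?_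
  obtain ⟨x, hx, hx'⟩ := exists_eigenvector_of_mem_spectrum hz
  exact hM z x hx hx'

/-- Convergence of the powers of a matrix with a simple dominant eigenvalue `1` to the rank-one
projection on its eigenspace. -/
theorem tendsto_pow_vecMulVec [Nonempty n] (M : Matrix n n ℂ) (u w : n → ℂ) (hu : M *ᵥ u = u)
    (hw : w ᵥ* M = w) (hwu : w ⬝ᵥ u = 1)
    (hone : ∀ x, M *ᵥ x = x → ∃ c : ℂ, x = c • u)
    (hlt : ∀ (z : ℂ) (x : n → ℂ), x ≠ 0 → M *ᵥ x = z • x → z ≠ 1 → ‖z‖ < 1) :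
    Tendsto (fun k : ℕ => M ^ k) atTop (𝓝 (vecMulVec u w)) := by
  set P := vecMulVec u w with hP
  have hMP : M * P = P := by rw [hP, mul_vecMulVec, hu]
  have hPM : P * M = P := by rw [hP, vecMulVec_mul, hw]
  have hPP : P * P = P := by
    rw [hP, vecMulVec_mul_vecMulVec, hwu, one_smul]
  -- This fails at exponent 0, where the left side is 1; hence the shift by one.
  have hpow : ∀ k : ℕ, (M - P) ^ (k + 1) = M ^ (k + 1) - P := by
    intro k
    induction k with
    | zero => simp
    | succ k ih =>
      have h1 : M ^ (k + 1) * P = P := by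
        clear ih
        induction k with
        | zero => simpa using hMP
        | succ k ih => rw [pow_succ, mul_assoc, hMP, ih]
      rw [pow_succ, ih, sub_mul, mul_sub, mul_sub, ← pow_succ, h1, hPM, hPP]
      abel
  have h0 : Tendsto (fun k : ℕ => (M - P) ^ k) atTop (𝓝 0) := by
    refine tendsto_matrix_pow_zero _ fun z x hx hzx => ?_
    by_cases hz : z = 0
    · simp [hz]
    -- As `P * (M - P) = 0`, an eigenvector with `z ≠ 0` is killed by `P` and so is an eigenvector
    -- of `M`. The value `z = 1` is excluded because `P` fixes `u`.
    have hPx : P *ᵥ x = 0 := by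
      have h1 : P *ᵥ ((M - P) *ᵥ x) = 0 := by
        rw [mulVec_mulVec, mul_sub, hPM, hPP, sub_self, zero_mulVec]
      rw [hzx, mulVec_smul] at h1
      exact (smul_eq_zero.mp h1).resolve_left hz
    rw [sub_mulVec, hPx, sub_zero] at hzx
    refine hlt z x hx hzx fun h1 => hx ?_
    obtain ⟨c, rfl⟩ := hone x (by simpa [h1] using hzx)
    have h2 : P *ᵥ u = u := by
      ext i
      simp [hP, vecMulVec_mulVec, hwu]
    rw [mulVec_smul, h2] at hPx
    exact hPx
  have h1 := ((tendsto_add_atTop_iff_nat 1).mpr h0).add_const P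
  rw [zero_add] at h1
  refine (tendsto_add_atTop_iff_nat 1).mp (h1.congr fun k => ?_)
  rw [hpow, sub_add_cancel]

end Powers

/-! ### Products of site-dependent tensors -/

section Products

theorem prod_ofFn_sum {R : Type*} [Semiring R] {ι : Type*} [Fintype ι] :
    ∀ {N : ℕ} (X : Fin N → ι → R),
      (List.ofFn fun i => ∑ s, X i s).prod = ∑ s : Fin N → ι, (List.ofFn fun i => X i (s i)).prod
  | 0, X => by simp
  | N + 1, X => by
    rw [List.ofFn_succ, List.prod_cons, prod_ofFn_sum, Finset.sum_mul_sum,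
      ← Fintype.sum_prod_type', ← (Fin.consEquiv fun _ => ι).sum_comp]
    refine Finset.sum_congr rfl fun p _ => ?_
    simp [Fin.consEquiv, List.ofFn_succ]

theorem prod_ofFn_smul {R : Type*} [Semiring R] [Algebra ℂ R] :
    ∀ {N : ℕ} (c : Fin N → ℂ) (X : Fin N → R),
      (List.ofFn fun i => c i • X i).prod = (∏ i, c i) • (List.ofFn X).prod
  | 0, c, X => by simp
  | N + 1, c, X => by
    simp only [List.ofFn_succ, List.prod_cons, Fin.prod_univ_succ]
    rw [prod_ofFn_smul, smul_mul_smul_comm]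

theorem prod_ofFn_kronecker {D : ℕ} :
    ∀ {N : ℕ} (X Y : Fin N → Matrix (Fin D) (Fin D) ℂ),
      (List.ofFn fun i => X i ⊗ₖ Y i).prod = (List.ofFn X).prod ⊗ₖ (List.ofFn Y).prod
  | 0, X, Y => by simp
  | N + 1, X, Y => by
    simp only [List.ofFn_succ, List.prod_cons]
    rw [prod_ofFn_kronecker, mul_kronecker_mul]

theorem prod_ofFn_modNat {R : Type*} [Monoid R] {k L : ℕ} (X : Fin L → R) :
    (List.ofFn fun i : Fin (k * L) => X i.modNat).prod = (List.ofFn X).prod ^ k := by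
  rw [List.ofFn_mul, List.prod_flatten, List.map_ofFn]
  have : (List.prod ∘ fun i : Fin k => List.ofFn fun j : Fin L =>
      X (Fin.modNat (⟨i * L + j, by
        calc (i : ℕ) * L + j < (i + 1) * L := by rw [add_mul, one_mul]; omega
          _ ≤ k * L := Nat.mul_le_mul_right _ i.2⟩ : Fin (k * L)))) =
      fun _ => (List.ofFn X).prod := by
    funext i
    simp only [Function.comp]
    congr 2
    funext j
    congr 1
    ext
    simp [Fin.modNat, Nat.mod_eq_of_lt j.2]
  rw [this]
  simp [List.ofFn_const]

end Products

/-- The mixed transfer matrix `∑ₛ Aˢ ⊗ (Bˢ)^*`. -/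
def mixedTransfer {d D : ℕ} (A B : Tensor d D) : Matrix (Fin D × Fin D) (Fin D × Fin D) ℂ :=
  ∑ s, A s ⊗ₖ (B s).map (starRingEnd ℂ)

theorem mixedTransfer_self {d D : ℕ} (A : Tensor d D) : mixedTransfer A A = transferMatrix A := rfl

/-- A product of two traces is the trace of a Kronecker product, so the sum over configurations
factorises site by site. -/
theorem sum_trace_mul_conj_trace {d D N : ℕ} (A B : Fin N → Tensor d D) :
    ∑ s : Fin N → Fin d, (List.ofFn fun i => A i (s i)).prod.trace *
        starRingEnd ℂ (List.ofFn fun i => B i (s i)).prod.trace =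
      (List.ofFn fun i => mixedTransfer (A i) (B i)).prod.trace := by
  unfold mixedTransfer
  rw [prod_ofFn_sum, trace_sum]
  refine Finset.sum_congr rfl fun s _ => ?_
  rw [prod_ofFn_kronecker, trace_kronecker]
  congr 1
  have h := map_list_prod ((starRingEnd ℂ).mapMatrix (m := Fin D)) (List.ofFn fun i => B i (s i))
  rw [List.map_ofFn] at h
  change _ = (List.ofFn (⇑(starRingEnd ℂ).mapMatrix ∘ fun i => B i (s i))).prod.trace
  rw [← h]
  simp [trace, Matrix.diag]

theorem onSiteOperator_mulVec_periodicState {d D N : ℕ} (A : Tensor d D)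
    (U : Fin N → Matrix.unitaryGroup (Fin d) ℂ) (s : Fin N → Fin d) :
    (onSiteOperator U *ᵥ periodicState A N) s =
      (List.ofFn fun i => physicalAction (U i) A (s i)).prod.trace := by
  unfold physicalAction
  rw [prod_ofFn_sum, trace_sum]
  refine Finset.sum_congr rfl fun t _ => ?_
  rw [prod_ofFn_smul, trace_smul, smul_eq_mul]
  rfl

/-- The overlap of the transformed state with the original one has the modulus of the norm
squared, expressed by traces of powers of transfer matrices. -/
theorem norm_trace_pow_eq {d D L : ℕ} (A : Tensor d D) (U : Fin L → Matrix.unitaryGroup (Fin d) ℂ)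
    (k : ℕ)
    (h : EqUpToPhase (onSiteOperator (periodicExtension U k) *ᵥ periodicState A (k * L))
      (periodicState A (k * L))) :
    ‖((List.ofFn fun j => mixedTransfer A (physicalAction (U j) A)).prod ^ k).trace‖ =
      ‖(transferMatrix A ^ (k * L)).trace‖ := by
  obtain ⟨θ, hθ⟩ := h
  have h1 := sum_trace_mul_conj_trace (fun _ : Fin (k * L) => A)
    (fun i => physicalAction (periodicExtension U k i) A)
  have h2 := sum_trace_mul_conj_trace (fun _ : Fin (k * L) => A) (fun _ => A)
  have h3 := prod_ofFn_modNat (k := k) fun j => mixedTransfer A (physicalAction (U j) A)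
  change (List.ofFn fun i : Fin (k * L) =>
    mixedTransfer A (physicalAction (periodicExtension U k i) A)).prod = _ at h3
  rw [h3] at h1
  simp only [List.ofFn_const, List.prod_replicate, mixedTransfer_self] at h2
  rw [← h1, ← h2]
  simp_rw [← onSiteOperator_mulVec_periodicState, hθ]
  simp only [Pi.smul_apply, smul_eq_mul, map_mul]
  have h4 : ∀ s : Fin (k * L) → Fin d,
      (List.ofFn fun i => A (s i)).prod.trace *
        (starRingEnd ℂ (Complex.exp (θ * Complex.I)) *
          starRingEnd ℂ (periodicState A (k * L) s)) =
      starRingEnd ℂ (Complex.exp (θ * Complex.I)) *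
        ((List.ofFn fun i => A (s i)).prod.trace *
          starRingEnd ℂ (List.ofFn fun i => A (s i)).prod.trace) := fun s => by
    rw [mul_left_comm]; rfl
  simp_rw [h4, ← Finset.mul_sum]
  rw [norm_mul, RCLike.norm_conj, Complex.norm_exp_ofReal_mul_I, one_mul]

/-! ### The mixed channel -/

/-- The adjoint `X ↦ ∑ₛ (Aˢ)† X Bˢ` of the map represented by the mixed transfer matrix. -/
def mixedChannel {d D : ℕ} (A B : Tensor d D) (X : Matrix (Fin D) (Fin D) ℂ) :
    Matrix (Fin D) (Fin D) ℂ :=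
  ∑ s, (A s)ᴴ * X * B s

section Channel

variable {d D : ℕ} (A B : Tensor d D)

/-- The transpose makes `vec` row-major, matching the index order of the Kronecker product. -/
theorem mixedTransfer_conjTranspose_mulVec (X : Matrix (Fin D) (Fin D) ℂ) :
    (mixedTransfer A B)ᴴ *ᵥ vec Xᵀ = vec (mixedChannel A B X)ᵀ := by
  simp only [mixedTransfer, mixedChannel, conjTranspose_sum, sum_mulVec, transpose_sum, vec_sum]
  refine Finset.sum_congr rfl fun s _ => ?_
  have h : ((B s).map (starRingEnd ℂ))ᴴ = (B s)ᵀ := by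
    ext i j; simp
  rw [conjTranspose_kronecker, h, kronecker_mulVec_vec]
  simp [transpose_mul, mul_assoc]

theorem transferMatrix_mulVec (X : Matrix (Fin D) (Fin D) ℂ) :
    transferMatrix A *ᵥ vec Xᵀ = vec (∑ s, A s * X * (A s)ᴴ)ᵀ := by
  simp only [transferMatrix, sum_mulVec, transpose_sum, vec_sum]
  refine Finset.sum_congr rfl fun s _ => ?_
  have h : (A s).map (starRingEnd ℂ) = ((A s)ᴴ)ᵀ := by
    ext i j; simp
  rw [h, kronecker_mulVec_vec]
  simp [transpose_mul, mul_assoc]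

/-- Expand the square: the fixed point of `B` gives `tr (X ρ Xᴴ)`, while by cyclicity both cross
terms and, using `∑ AᴴA = 1`, the last term all equal `tr (Y ρ Yᴴ)`. -/
theorem sum_trace_defect {ρ : Matrix (Fin D) (Fin D) ℂ} (hA : ∑ s, (A s)ᴴ * A s = 1)
    (hB : ∑ s, B s * ρ * (B s)ᴴ = ρ) (X : Matrix (Fin D) (Fin D) ℂ) :
    ∑ s, trace ((X * B s - A s * mixedChannel A B X) * ρ *
        (X * B s - A s * mixedChannel A B X)ᴴ) =
      trace (X * ρ * Xᴴ) - trace (mixedChannel A B X * ρ * (mixedChannel A B X)ᴴ) := by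
  set Y := mixedChannel A B X with hY
  have hYs : Yᴴ = ∑ s, (B s)ᴴ * Xᴴ * A s := by
    rw [hY, mixedChannel, conjTranspose_sum]
    simp [conjTranspose_mul, mul_assoc]
  have h1 : ∑ s, trace (X * B s * ρ * (X * B s)ᴴ) = trace (X * ρ * Xᴴ) := by
    rw [← trace_sum]
    conv_rhs => rw [← hB]
    simp [Finset.mul_sum, Finset.sum_mul, mul_assoc]
  have h2 : ∑ s, trace (X * B s * ρ * (A s * Y)ᴴ) = trace (Y * ρ * Yᴴ) := by
    have : trace (Y * ρ * Yᴴ) = ∑ s, trace ((A s)ᴴ * X * B s * (ρ * Yᴴ)) := by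
      rw [mul_assoc, ← trace_sum, ← Finset.sum_mul]
      rfl
    rw [this]
    refine Finset.sum_congr rfl fun s _ => ?_
    rw [conjTranspose_mul, ← mul_assoc, trace_mul_comm]
    simp only [mul_assoc]
  have h3 : ∑ s, trace (A s * Y * ρ * (X * B s)ᴴ) = trace (Y * ρ * Yᴴ) := by
    conv_rhs => rw [hYs, Finset.mul_sum, trace_sum]
    refine Finset.sum_congr rfl fun s _ => ?_
    rw [conjTranspose_mul, mul_assoc, mul_assoc, trace_mul_comm]
    simp only [mul_assoc]
  have h4 : ∑ s, trace (A s * Y * ρ * (A s * Y)ᴴ) = trace (Y * ρ * Yᴴ) := by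
    have : trace (Y * ρ * Yᴴ) = trace ((∑ s, (A s)ᴴ * A s) * (Y * ρ * Yᴴ)) := by
      rw [hA, one_mul]
    rw [this, Finset.sum_mul, trace_sum]
    refine Finset.sum_congr rfl fun s _ => ?_
    rw [conjTranspose_mul, ← mul_assoc, trace_mul_comm]
    simp only [mul_assoc]
  simp only [conjTranspose_sub, sub_mul, mul_sub, trace_sub, Finset.sum_sub_distrib, h1, h2, h3, h4]
  ring

variable {A B}

theorem trace_mixedChannel_le {ρ : Matrix (Fin D) (Fin D) ℂ} (hρ : ρ.PosDef)
    (hA : ∑ s, (A s)ᴴ * A s = 1) (hB : ∑ s, B s * ρ * (B s)ᴴ = ρ)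
    (X : Matrix (Fin D) (Fin D) ℂ) :
    trace (mixedChannel A B X * ρ * (mixedChannel A B X)ᴴ) ≤ trace (X * ρ * Xᴴ) := by
  rw [← sub_nonneg, ← sum_trace_defect A B hA hB X]
  exact Finset.sum_nonneg fun s _ =>
    (hρ.posSemidef.mul_mul_conjTranspose_same _).trace_nonneg

theorem eq_zero_of_trace_eq_zero {ρ : Matrix (Fin D) (Fin D) ℂ} (hρ : ρ.PosDef)
    {X : Matrix (Fin D) (Fin D) ℂ} (h : trace (X * ρ * Xᴴ) = 0) : X = 0 := by
  rw [(hρ.posSemidef.mul_mul_conjTranspose_same X).trace_eq_zero_iff] at h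
  rw [← conjTranspose_eq_zero]
  refine Matrix.ext_of_mulVec_single fun i => ?_
  rw [zero_mulVec]
  by_contra hv
  have h1 := hρ.dotProduct_mulVec_pos hv
  rw [star_mulVec, conjTranspose_conjTranspose, mulVec_mulVec, ← dotProduct_mulVec, mulVec_mulVec,
    ← mul_assoc, h] at h1
  simp at h1

theorem mul_eq_mul_mixedChannel {ρ : Matrix (Fin D) (Fin D) ℂ} (hρ : ρ.PosDef)
    (hA : ∑ s, (A s)ᴴ * A s = 1) (hB : ∑ s, B s * ρ * (B s)ᴴ = ρ)
    {X : Matrix (Fin D) (Fin D) ℂ}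
    (h : trace (mixedChannel A B X * ρ * (mixedChannel A B X)ᴴ) = trace (X * ρ * Xᴴ)) (s : Fin d) :
    X * B s = A s * mixedChannel A B X := by
  have h1 := sum_trace_defect A B hA hB X
  rw [h, sub_self, Finset.sum_eq_zero_iff_of_nonneg fun s _ =>
    (hρ.posSemidef.mul_mul_conjTranspose_same _).trace_nonneg] at h1
  exact sub_eq_zero.mp (eq_zero_of_trace_eq_zero hρ (h1 s (Finset.mem_univ s)))

end Channel

/-! ### Invariance of the channels under unitary mixing of the Kraus operators -/

section PhysicalAction

variable {d D : ℕ} (U : Matrix.unitaryGroup (Fin d) ℂ) (A : Tensor d D)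

theorem sum_star_mul_unitary (t t' : Fin d) :
    ∑ s, star ((U : Matrix (Fin d) (Fin d) ℂ) s t') * (U : Matrix (Fin d) (Fin d) ℂ) s t =
      if t' = t then 1 else 0 := by
  have h := congrFun (congrFun (Matrix.mem_unitaryGroup_iff'.mp U.2) t') t
  rwa [mul_apply, one_apply] at h

theorem sum_physicalAction_mul (M : Matrix (Fin D) (Fin D) ℂ) :
    ∑ s, physicalAction U A s * M * (physicalAction U A s)ᴴ = ∑ s, A s * M * (A s)ᴴ := by
  have h : ∀ s, physicalAction U A s * M * (physicalAction U A s)ᴴ =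
      ∑ t, ∑ t', (star ((U : Matrix (Fin d) (Fin d) ℂ) s t') *
        (U : Matrix (Fin d) (Fin d) ℂ) s t) • (A t * M * (A t')ᴴ) := fun s => by
    simp only [physicalAction, conjTranspose_sum, Finset.sum_mul, Finset.mul_sum,
      conjTranspose_smul, smul_mul_assoc, mul_smul_comm, Finset.smul_sum, smul_smul]
    rw [Finset.sum_comm]
  simp_rw [h]
  rw [Finset.sum_comm]
  refine Finset.sum_congr rfl fun t _ => ?_
  rw [Finset.sum_comm]
  simp_rw [← Finset.sum_smul, sum_star_mul_unitary]
  simp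

theorem sum_conjTranspose_physicalAction_mul (M : Matrix (Fin D) (Fin D) ℂ) :
    ∑ s, (physicalAction U A s)ᴴ * M * physicalAction U A s = ∑ s, (A s)ᴴ * M * A s := by
  have h : ∀ s, (physicalAction U A s)ᴴ * M * physicalAction U A s =
      ∑ t, ∑ t', (star ((U : Matrix (Fin d) (Fin d) ℂ) s t') *
        (U : Matrix (Fin d) (Fin d) ℂ) s t) • ((A t')ᴴ * M * A t) := fun s => by
    simp only [physicalAction, conjTranspose_sum, Finset.sum_mul, Finset.mul_sum,
      conjTranspose_smul, smul_mul_assoc, mul_smul_comm, Finset.smul_sum, smul_smul]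
    simp only [mul_comm]
  simp_rw [h]
  rw [Finset.sum_comm]
  refine Finset.sum_congr rfl fun t _ => ?_
  rw [Finset.sum_comm]
  simp_rw [← Finset.sum_smul, sum_star_mul_unitary]
  simp

end PhysicalAction

/-! ### The spectrum of the transfer matrix -/

theorem exists_vec_transpose_eq {D : ℕ} (x : Fin D × Fin D → ℂ) :
    ∃ X : Matrix (Fin D) (Fin D) ℂ, vec Xᵀ = x :=
  ⟨Matrix.of fun a b => x (a, b), rfl⟩

theorem trace_smul_mul {D : ℕ} (z : ℂ) (X ρ : Matrix (Fin D) (Fin D) ℂ) :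
    trace ((z • X) * ρ * (z • X)ᴴ) = (‖z‖ ^ 2 : ℝ) • trace (X * ρ * Xᴴ) := by
  rw [conjTranspose_smul, smul_mul_assoc, smul_mul_assoc, mul_smul_comm, smul_smul, trace_smul,
    smul_eq_mul, RCLike.star_def, Complex.mul_conj', Complex.real_smul]
  push_cast
  rfl

/-- Rank-nullity for `M - μ` and its adjoint, which have equal rank. -/
theorem finrank_eigenspace_conjTranspose {n : Type*} [Fintype n] [DecidableEq n]
    (M : Matrix n n ℂ) (μ : ℂ) :
    Module.finrank ℂ (Module.End.eigenspace (Matrix.toLin' Mᴴ) (star μ)) =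
      Module.finrank ℂ (Module.End.eigenspace (Matrix.toLin' M) μ) := by
  have key : ∀ (N : Matrix n n ℂ) (z : ℂ),
      (N - z • 1).rank + Module.finrank ℂ (Module.End.eigenspace (Matrix.toLin' N) z) =
        Fintype.card n := fun N z => by
    have h : Module.End.eigenspace (Matrix.toLin' N) z =
        LinearMap.ker (Matrix.toLin' (N - z • 1)) := by
      rw [Module.End.eigenspace_def]
      congr 1
      simp [Module.End.one_eq_id]
    rw [h, Matrix.rank, ← Matrix.toLin'_apply', LinearMap.finrank_range_add_finrank_ker]
    simp
  have h1 := key M μ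
  have h2 := key Mᴴ (star μ)
  have h3 : (Mᴴ - star μ • 1 : Matrix n n ℂ) = (M - μ • 1)ᴴ := by simp
  rw [h3, rank_conjTranspose] at h2
  omega

theorem exists_tendsto_transferMatrix_pow {d D : ℕ} [NeZero D] {A : Tensor d D}
    (hcan : IsLeftCanonical A) (hinj : IsInjective A) :
    ∃ w : Fin D × Fin D → ℂ, w ⬝ᵥ vec (1 : Matrix (Fin D) (Fin D) ℂ)ᵀ = 1 ∧
      Tendsto (fun k : ℕ => (transferMatrix A)ᴴ ^ k) atTop
        (𝓝 (vecMulVec (vec (1 : Matrix (Fin D) (Fin D) ℂ)ᵀ) w)) := by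
  obtain ⟨ρ, hρ, hAρ⟩ := hcan.right_fixed
  obtain ⟨μ, hμ1, hμ⟩ := hinj
  have hone : (transferMatrix A)ᴴ *ᵥ vec (1 : Matrix (Fin D) (Fin D) ℂ)ᵀ =
      vec (1 : Matrix (Fin D) (Fin D) ℂ)ᵀ := by
    rw [← mixedTransfer_self, mixedTransfer_conjTranspose_mulVec, mixedChannel]
    simp [hcan.left_fixed]
  have hone0 : vec (1 : Matrix (Fin D) (Fin D) ℂ)ᵀ ≠ 0 := by
    rw [Ne, vec_eq_zero_iff, transpose_one]; exact one_ne_zero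
  have heig : ∀ (z : ℂ) (x : Fin D × Fin D → ℂ), x ≠ 0 → (transferMatrix A)ᴴ *ᵥ x = z • x →
      Module.End.HasEigenvalue (Matrix.toLin' (transferMatrix A)) (star z) := by
    intro z x hx hzx
    have h1 := finrank_eigenspace_conjTranspose (transferMatrix A) (star z)
    rw [star_star] at h1
    rw [Module.End.hasEigenvalue_iff]
    intro h2
    rw [h2, finrank_bot, Submodule.finrank_eq_zero] at h1
    have h3 : x ∈ Module.End.eigenspace (Matrix.toLin' (transferMatrix A)ᴴ) z := by
      rw [Module.End.mem_eigenspace_iff]; simpa using hzx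
    rw [h1] at h3
    exact hx (by simpa using h3)
  have hle : ∀ (z : ℂ) (x : Fin D × Fin D → ℂ), x ≠ 0 → (transferMatrix A)ᴴ *ᵥ x = z • x →
      ‖z‖ ≤ 1 := by
    intro z x hx hzx
    obtain ⟨X, rfl⟩ := exists_vec_transpose_eq x
    rw [← mixedTransfer_self, mixedTransfer_conjTranspose_mulVec, ← vec_smul, vec_inj,
      ← transpose_smul, transpose_inj] at hzx
    have h1 := trace_mixedChannel_le hρ hcan.left_fixed hAρ X
    rw [hzx, trace_smul_mul] at h1
    have h2 : 0 ≤ trace (X * ρ * Xᴴ) := (hρ.posSemidef.mul_mul_conjTranspose_same X).trace_nonneg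
    have h3 : trace (X * ρ * Xᴴ) ≠ 0 := fun h => hx (by
      rw [eq_zero_of_trace_eq_zero hρ h]; rfl)
    have h4 : 0 < (trace (X * ρ * Xᴴ)).re := (Complex.pos_iff.mp (lt_of_le_of_ne h2 h3.symm)).1
    have h5 := (Complex.le_def.mp h1).1
    rw [Complex.smul_re, smul_eq_mul] at h5
    have h6 : ‖z‖ ^ 2 ≤ 1 := by
      by_contra! h
      nlinarith
    nlinarith [norm_nonneg z]
  -- Since 1 is an eigenvalue, `μ ≠ 1` would give `1 < ‖μ‖` by dominance, against the contraction
  -- bound `hle`.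
  have hμ_one : μ = 1 := by
    by_contra h
    have h1 := hμ 1 (by simpa using heig 1 _ hone0 (by simpa using hone)) (Ne.symm h)
    have h2 : Module.finrank ℂ
        (Module.End.eigenspace (Matrix.toLin' (transferMatrix A)ᴴ) (star μ)) = 1 := by
      rw [finrank_eigenspace_conjTranspose, hμ1]
    obtain ⟨⟨x, hx⟩, hx0, -⟩ := finrank_eq_one_iff'.mp h2
    rw [Module.End.mem_eigenspace_iff, Matrix.toLin'_apply] at hx
    have h3 := hle (star μ) x (fun h => hx0 (by simpa using h)) hx
    rw [norm_star] at h3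
    rw [norm_one] at h1
    linarith
  subst hμ_one
  have hfix : ∀ x, (transferMatrix A)ᴴ *ᵥ x = x →
      ∃ c : ℂ, x = c • vec (1 : Matrix (Fin D) (Fin D) ℂ)ᵀ := by
    intro x hx
    have h2 := finrank_eigenspace_conjTranspose (transferMatrix A) 1
    rw [star_one, hμ1] at h2
    have hmem : ∀ y, (transferMatrix A)ᴴ *ᵥ y = y →
        y ∈ Module.End.eigenspace (Matrix.toLin' (transferMatrix A)ᴴ) 1 := fun y hy => by
      rw [Module.End.mem_eigenspace_iff, Matrix.toLin'_apply, hy, one_smul]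
    obtain ⟨c, hc⟩ := (finrank_eq_one_iff_of_nonzero' (⟨_, hmem _ hone⟩ :
      Module.End.eigenspace (Matrix.toLin' (transferMatrix A)ᴴ) 1)
        (fun h => hone0 (congrArg Subtype.val h))).mp h2 ⟨x, hmem x hx⟩
    exact ⟨c, (congrArg Subtype.val hc).symm⟩
  have htr : trace ρ ≠ 0 := hρ.trace_pos.ne'
  -- The left fixed vector of `Eᴴ` comes from `ρ`, normalised by its trace.
  have hwu : ((trace ρ)⁻¹ • star (vec ρᵀ)) ⬝ᵥ vec (1 : Matrix (Fin D) (Fin D) ℂ)ᵀ = 1 := by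
    have h : star (vec ρᵀ) ⬝ᵥ vec (1 : Matrix (Fin D) (Fin D) ℂ)ᵀ = trace ρ := by
      rw [star_vec, vec_dotProduct_vec, transpose_one, mul_one]
      change trace ρᵀᴴᵀ.transpose = _
      conv_rhs => rw [← hρ.isHermitian]
      simp [trace]
    rw [smul_dotProduct, h, smul_eq_mul, inv_mul_cancel₀ htr]
  refine ⟨_, hwu, tendsto_pow_vecMulVec _ _ _ hone ?_ hwu hfix ?_⟩
  · rw [smul_vecMul, vecMul_conjTranspose, star_star, transferMatrix_mulVec, hAρ]
  · intro z x hx hzx hz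
    have h := hμ (star z) (heig z x hx hzx) (fun h => hz (by
      rw [← star_star z, h, star_one]))
    simpa using h

/-! ### Virtual unitaries of a modulated symmetry -/

/-- The adjoint reverses the product, so the first site acts first. -/
theorem exists_chain {n : Type*} [Fintype n] [DecidableEq n] :
    ∀ {L : ℕ} (M : Fin L → Matrix n n ℂ) (x₀ : n → ℂ), ∃ x : Fin (L + 1) → n → ℂ,
      x 0 = x₀ ∧ (∀ j : Fin L, x j.succ = (M j)ᴴ *ᵥ x j.castSucc) ∧
        x (Fin.last L) = (List.ofFn M).prodᴴ *ᵥ x₀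
  | 0, M, x₀ => ⟨fun _ => x₀, rfl, fun j => j.elim0, by simp⟩
  | L + 1, M, x₀ => by
    obtain ⟨x, hx0, hx, hxL⟩ := exists_chain (fun j => M j.succ) ((M 0)ᴴ *ᵥ x₀)
    refine ⟨Fin.cons x₀ x, rfl, fun j => ?_, ?_⟩
    · refine Fin.cases ?_ (fun i => ?_) j
      · simp [hx0]
      · rw [Fin.cons_succ, ← Fin.succ_castSucc, Fin.cons_succ, hx]
    · rw [← Fin.succ_last, Fin.cons_succ, hxL, List.ofFn_succ, List.prod_cons,
        conjTranspose_mul, mulVec_mulVec]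

theorem tendsto_norm_trace {n : Type*} [Fintype n] {f : ℕ → Matrix n n ℂ} {M : Matrix n n ℂ}
    (h : Tendsto f atTop (𝓝 M)) : Tendsto (fun k => ‖(f k).trace‖) atTop (𝓝 ‖M.trace‖) :=
  ((continuous_id.matrix_trace.tendsto M).comp h).norm

/-- The mixed transfer matrix over a unit cell has an eigenvalue of modulus at least `1`. -/
theorem exists_peripheral_eigenvector {d D L : ℕ} [NeZero D] (hL : 0 < L) {A : Tensor d D}
    {w u : Fin D × Fin D → ℂ} (hwu : w ⬝ᵥ u = 1)
    (hw : Tendsto (fun k : ℕ => (transferMatrix A)ᴴ ^ k) atTop (𝓝 (vecMulVec u w)))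
    (U : Fin L → Matrix.unitaryGroup (Fin d) ℂ)
    (hsym : ∀ k : ℕ, 1 ≤ k →
      EqUpToPhase (onSiteOperator (periodicExtension U k) *ᵥ periodicState A (k * L))
        (periodicState A (k * L))) :
    ∃ (z : ℂ) (x : Fin D × Fin D → ℂ), x ≠ 0 ∧
      (List.ofFn fun j => mixedTransfer A (physicalAction (U j) A)).prodᴴ *ᵥ x = z • x ∧
        1 ≤ ‖z‖ := by
  set M := (List.ofFn fun j => mixedTransfer A (physicalAction (U j) A)).prod
  -- Otherwise the traces of the powers of `Mᴴ` tend to 0, while symmetry makes their moduli tend to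
  -- 1.
  by_contra! hcon
  have h0 := tendsto_norm_trace (tendsto_matrix_pow_zero Mᴴ hcon)
  have h1 := (tendsto_norm_trace hw).comp
    (tendsto_atTop_mono (fun k : ℕ => Nat.le_mul_of_pos_right k hL) tendsto_id)
  rw [trace_vecMulVec, dotProduct_comm, hwu, norm_one] at h1
  rw [trace_zero, norm_zero] at h0
  have h2 : (fun k : ℕ => ‖(Mᴴ ^ k).trace‖) =ᶠ[atTop]
      ((fun k => ‖((transferMatrix A)ᴴ ^ k).trace‖) ∘ fun k => k * L) := by
    filter_upwards [eventually_ge_atTop 1] with k hk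
    have := norm_trace_pow_eq A U k (hsym k hk)
    simp only [Function.comp, ← conjTranspose_pow, trace_conjTranspose, norm_star]
    exact this
  exact zero_ne_one (tendsto_nhds_unique (h0.congr' h2) h1)

theorem exists_bond_unitaries {d D L : ℕ} (A : Tensor d D) (hcan : IsLeftCanonical A)
    (hinj : IsInjective A) (U : Fin L → Matrix.unitaryGroup (Fin d) ℂ)
    (hsym : ∀ k : ℕ, 1 ≤ k →
      EqUpToPhase (onSiteOperator (periodicExtension U k) *ᵥ periodicState A (k * L))
        (periodicState A (k * L))) :
    ∃ v : Fin (L + 1) → Matrix.unitaryGroup (Fin D) ℂ,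
      (∀ j : Fin L, EqUpToPhase (physicalAction (U j) A)
        (bondAction (v j.castSucc) (v j.succ) A)) ∧
      EqUpToPhase (v 0 : Matrix (Fin D) (Fin D) ℂ)
        (v (Fin.last L) : Matrix (Fin D) (Fin D) ℂ) := by
  rcases Nat.eq_zero_or_pos L with rfl | hL
  · exact ⟨fun _ => 1, fun j => j.elim0, 0, by simp⟩
  -- Bond dimension 0 admits no one-dimensional eigenspace.
  have hD : NeZero D := by
    refine ⟨?_⟩
    rintro rfl
    obtain ⟨μ, hμ, -⟩ := hinj
    rw [Module.finrank_zero_of_subsingleton] at hμ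
    exact zero_ne_one hμ
  obtain ⟨w, hwu, hw⟩ := exists_tendsto_transferMatrix_pow hcan hinj
  obtain ⟨z, x₀, hx₀, hzx, hz⟩ := exists_peripheral_eigenvector hL hwu hw U hsym
  obtain ⟨ρ, hρ, hAρ⟩ := hcan.right_fixed
  obtain ⟨x, hx0, hx, hxL⟩ :=
    exists_chain (fun j => mixedTransfer A (physicalAction (U j) A)) x₀
  choose X hX using fun j => exists_vec_transpose_eq (x j)
  have hXsucc : ∀ j : Fin L,
      X j.succ = mixedChannel A (physicalAction (U j) A) (X j.castSucc) := fun j => by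
    rw [← transpose_inj, ← vec_inj, hX, hx, ← hX, mixedTransfer_conjTranspose_mulVec]
  have hXL : X (Fin.last L) = z • X 0 := by
    rw [← transpose_inj, ← vec_inj, hX, hxL, hzx, transpose_smul, vec_smul, hX, hx0]
  have hX0 : X 0 ≠ 0 := fun h => hx₀ (by rw [← hx0, ← hX, h]; rfl)
  have hBρ : ∀ j, ∑ s, physicalAction (U j) A s * ρ * (physicalAction (U j) A s)ᴴ = ρ := fun j => by
    rw [sum_physicalAction_mul, hAρ]
  -- The weighted norms of the `X j` decrease along the unit cell, so they are all equal.
  have hanti : Antitone fun j => trace (X j * ρ * (X j)ᴴ) := by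
    refine Fin.antitone_iff_succ_le.mpr fun j => ?_
    simp only [hXsucc]
    exact trace_mixedChannel_le hρ hcan.left_fixed (hBρ j) _
  have hpos : 0 < trace (X 0 * ρ * (X 0)ᴴ) :=
    lt_of_le_of_ne (hρ.posSemidef.mul_mul_conjTranspose_same _).trace_nonneg
      fun h => hX0 (eq_zero_of_trace_eq_zero hρ h.symm)
  have hlast : trace (X (Fin.last L) * ρ * (X (Fin.last L))ᴴ) =
      (‖z‖ ^ 2 : ℝ) • trace (X 0 * ρ * (X 0)ᴴ) := by
    rw [hXL, trace_smul_mul]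
  have hz1 : ‖z‖ = 1 := by
    have h1 := hanti (Fin.zero_le (Fin.last L))
    simp only [hlast] at h1
    have h2 := (Complex.le_def.mp h1).1
    rw [Complex.smul_re, smul_eq_mul] at h2
    have h3 := (Complex.pos_iff.mp hpos).1
    have h4 : ‖z‖ ^ 2 ≤ 1 := by
      by_contra! h
      nlinarith
    nlinarith
  rw [hz1, one_pow, one_smul] at hlast
  have hconst : ∀ j, trace (X j * ρ * (X j)ᴴ) = trace (X 0 * ρ * (X 0)ᴴ) := fun j =>
    le_antisymm (hanti (Fin.zero_le j)) (hlast ▸ hanti (Fin.le_last j))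
  have hmul : ∀ (j : Fin L) (s : Fin d),
      X j.castSucc * physicalAction (U j) A s = A s * X j.succ := fun j s => by
    rw [hXsucc]
    refine mul_eq_mul_mixedChannel hρ hcan.left_fixed (hBρ j) ?_ s
    rw [← hXsucc, hconst, hconst j.castSucc]
  -- The matrices `(X j)† X j` are propagated by the channel of `A`.
  have hgram : ∀ j : Fin L, (X j.succ)ᴴ * X j.succ =
      mixedChannel A A ((X j.castSucc)ᴴ * X j.castSucc) := fun j => by
    -- Unitarity replaces `A` by `U j · A`, to which the intertwining relation applies.
    rw [mixedChannel, ← sum_conjTranspose_physicalAction_mul (U j)]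
    have h1 : ∀ s, (physicalAction (U j) A s)ᴴ * ((X j.castSucc)ᴴ * X j.castSucc) *
        physicalAction (U j) A s = (X j.succ)ᴴ * ((A s)ᴴ * A s) * X j.succ := fun s => by
      have h2 := congrArg conjTranspose (hmul j s)
      rw [conjTranspose_mul, conjTranspose_mul] at h2
      rw [← mul_assoc, h2, mul_assoc, hmul]
      simp only [mul_assoc]
    simp_rw [h1]
    rw [← Finset.sum_mul, ← Finset.mul_sum, hcan.left_fixed, mul_one]
  have hgramL : (X (Fin.last L))ᴴ * X (Fin.last L) = (X 0)ᴴ * X 0 := by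
    rw [hXL, conjTranspose_smul, smul_mul_smul_comm, RCLike.star_def, mul_comm,
      Complex.mul_conj', hz1]
    simp
  set q := vec ((X 0)ᴴ * X 0)ᵀ with hq
  have hcell : ((transferMatrix A)ᴴ ^ L) *ᵥ q = q := by
    have h1 : ∀ j : Fin (L + 1), ((transferMatrix A)ᴴ ^ (j : ℕ)) *ᵥ q =
        vec ((X j)ᴴ * X j)ᵀ := fun j => by
      induction j using Fin.induction with
      | zero => simp [hq]
      | succ j ih =>
        rw [Fin.val_succ, pow_succ', ← mulVec_mulVec, ← Fin.val_castSucc, ih,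
          ← mixedTransfer_self, mixedTransfer_conjTranspose_mulVec, hgram]
    simpa only [hgramL, Fin.val_last] using h1 (Fin.last L)
  have hcells : ∀ k : ℕ, ((transferMatrix A)ᴴ ^ (k * L)) *ᵥ q = q := fun k => by
    induction k with
    | zero => simp
    | succ k ih => rw [add_mul, one_mul, pow_add, ← mulVec_mulVec, hcell, ih]
  -- In the limit `q` equals its image under the rank-one projection, a multiple of the vectorised
  -- identity.
  obtain ⟨c, hc⟩ : ∃ c : ℂ, (X 0)ᴴ * X 0 = c • 1 := by
    have h1 := hw.comp (tendsto_atTop_mono (fun k : ℕ => Nat.le_mul_of_pos_right k hL) tendsto_id)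
    have hcont : Continuous fun M : Matrix (Fin D × Fin D) (Fin D × Fin D) ℂ => M *ᵥ q :=
      continuous_id.matrix_mulVec continuous_const
    have h2 := (hcont.tendsto _).comp h1
    have h3 := tendsto_nhds_unique (h2.congr hcells) tendsto_const_nhds
    refine ⟨w ⬝ᵥ q, ?_⟩
    rw [← transpose_inj, ← vec_inj]
    refine h3.symm.trans ?_
    ext i
    simp [vecMulVec_mulVec, mul_comm, one_apply, eq_comm]
  have hcall : ∀ j, (X j)ᴴ * X j = c • 1 := fun j => by
    induction j using Fin.induction with
    | zero => exact hc
    | succ j ih =>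
      rw [hgram, ih, mixedChannel]
      simp [← Finset.smul_sum, hcan.left_fixed]
  have hcpos : 0 < c := by
    have h1 : trace ((X 0)ᴴ * X 0) = c * D := by simp [hc]
    have h2 : 0 < trace ((X 0)ᴴ * X 0) :=
      lt_of_le_of_ne (posSemidef_conjTranspose_mul_self _).trace_nonneg
        fun h => hX0 (trace_conjTranspose_mul_self_eq_zero_iff.mp h.symm)
    rw [h1] at h2
    exact pos_of_mul_pos_left h2 (by positivity)
  -- `r = 1 / √c` is the factor that makes every `X j` unitary.
  obtain ⟨r, hr, rfl⟩ : ∃ r : ℝ, 0 < r ∧ ((r : ℂ)⁻¹ * (r : ℂ)⁻¹) = c := by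
    obtain ⟨h1, h2⟩ := Complex.pos_iff.mp hcpos
    refine ⟨(Real.sqrt c.re)⁻¹, by positivity, ?_⟩
    rw [Complex.ofReal_inv, inv_inv, ← Complex.ofReal_mul, Real.mul_self_sqrt h1.le]
    exact Complex.ext rfl h2
  have hr0 : (r : ℂ) ≠ 0 := by exact_mod_cast hr.ne'
  have hunit : ∀ j, (r : ℂ) • X j ∈ Matrix.unitaryGroup (Fin D) ℂ := fun j => by
    rw [Matrix.mem_unitaryGroup_iff', star_eq_conjTranspose, conjTranspose_smul,
      smul_mul_smul_comm, hcall, smul_smul, RCLike.star_def, Complex.conj_ofReal]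
    rw [← mul_inv, mul_inv_cancel₀ (mul_ne_zero hr0 hr0), one_smul]
  -- All site phases are 0; the only phase, `z⁻¹`, sits in the closing relation between the two ends
  -- of the cell.
  refine ⟨fun j => ⟨(r : ℂ) • X j, hunit j⟩, fun j => ⟨0, ?_⟩, ?_⟩
  · funext s
    simp only [Complex.ofReal_zero, zero_mul, Complex.exp_zero, one_smul, bondAction]
    have h1 := Matrix.mem_unitaryGroup_iff'.mp (hunit j.castSucc)
    rw [mul_assoc, mul_smul_comm, ← hmul, ← smul_mul_assoc, ← mul_assoc, ← star_eq_conjTranspose,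
      h1, one_mul]
  · refine ⟨-Complex.arg z, ?_⟩
    have h1 : z = Complex.exp (Complex.arg z * Complex.I) := by
      have := Complex.norm_mul_exp_arg_mul_I z
      rw [hz1, Complex.ofReal_one, one_mul] at this
      exact this.symm
    change (r : ℂ) • X 0 = _ • ((r : ℂ) • X (Fin.last L))
    rw [hXL, smul_comm (r : ℂ) z, smul_smul]
    nth_rw 2 [h1]
    rw [← Complex.exp_add]
    simp

end ModulatedMPS

end

theorem mainTheorem1 {G : Type*} {d D L : ℕ}
    (A : ModulatedMPS.Tensor d D)
    (hcan : ModulatedMPS.IsLeftCanonical A)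
    (hinj : ModulatedMPS.IsInjective A)
    (U : G → Fin L → Matrix.unitaryGroup (Fin d) ℂ)
    (hsym : ∀ (g : G) (k : ℕ), 1 ≤ k →
      ModulatedMPS.EqUpToPhase
        (ModulatedMPS.onSiteOperator (ModulatedMPS.periodicExtension (U g) k) *ᵥ
          ModulatedMPS.periodicState A (k * L))
        (ModulatedMPS.periodicState A (k * L))) :
    ∃ v : G → Fin (L + 1) → Matrix.unitaryGroup (Fin D) ℂ, ∀ g : G,
      (∀ j : Fin L, ModulatedMPS.EqUpToPhase
        (ModulatedMPS.physicalAction (U g j) A)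
        (ModulatedMPS.bondAction (v g j.castSucc) (v g j.succ) A)) ∧
      ModulatedMPS.EqUpToPhase
        (v g 0 : Matrix (Fin D) (Fin D) ℂ)
        (v g (Fin.last L) : Matrix (Fin D) (Fin D) ℂ) := by
  choose v hv using fun g => ModulatedMPS.exists_bond_unitaries A hcan hinj (U g) (hsym g)
  exact ⟨v, hv⟩
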